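/- Let $m\ge 1$ and $n=2^m$. Write $\mathbf s_n=(s_0,\dots,s_{n-1})$ for a binary sequence of length $n$, $L(\mathbf s_n)=(s_1,\dots,s_{n-1},s_0)$ for its left circular shift, and $\mathbf s_n^\infty$ for its periodic repetition. A finite sequence is aperiodic if it is not a repetition of a shorter one. The nonlinear complexity of an infinite sequence is the length of a shortest feedback shift register (with arbitrary feedback function) generating it, and $\mathcal P(n,\omega)$ is the set of infinite binary sequences of (least) period $n$ and nonlinear complexity $\omega$. For $1\le c<n$, let $\mathcal B(n,c)$ be the set of aperiodic binary sequences $\mathbf s_n$ such that, for some $d$ with $1\le d\le\min\{n-c,\lfloor n/2\rfloor\}$, the block $(s_0,\dots,s_{d-1})$ is aperiodic and $\mathbf s_n$ starts with the $c+d$ terms $(s_0,\dots,s_{d-1})^q(s_0,\dots,s_{r-1},s_r\oplus 1)$, where $c+d-1=qd+r$ and $0\le r<d$; let $\mathcal B(n,c)=\emptyset$ for $c\ge n$. Let $\widetilde{\mathcal B}_0(n,m)$ be the set of binary sequences $\mathbf s_n$ with $s_0=\dots=s_{m-1}=0$, $s_m=1$, $s_{n-1}=1$ such that one period of $\mathbf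 s_n^\infty$ contains exactly $2^{m-2-i}$ runs of zeros and $2^{m-2-i}$ runs of ones of length $i$ for each $1\le i<m-1$, no run of zeros or of ones of length $m-1$ (if $m\geq 2$), and exactly one run of zeros and exactly one run of ones of length $m$ (a run of length $k$ of a symbol being $k$ consecutive copies of it flanked on both sides by the other symbol). Let $$\mathcal S(n,m)=\{\mathbf s_n\in\widetilde{\mathcal B}_0(n,m): L^k(\mathbf s_n)\notin\mathcal B(n,m+1)\text{ for all }0<k<n\}.$$ Then the set of binary de Bruijn sequences of order $m$ (the sequences of period $2^m$ in which every binary $m$-tuple occurs exactly once per period) is $\mathcal P(n,m)$, and $$\mathcal P(n,m)=\{(L^k(\mathbf s_n))^\infty:\ \mathbf s_n\in\mathcal S(n,m),\ 0\le k<n\}.$$ Moreover, if $m\ge 2$, then $$|\widetilde{\mathcal B}_0(n,m)|=\frac1{2^{m-2}}\left(\frac{(2^{m-2})!}{(2^{m-3})!\,(2^{m-4})!\cdots (2^1)!\,(2^0)!}\right)^2,$$ where for $m=2$ the product in the denominator is empty, i.e. equal to $1$. -/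

import Mathlib

namespace DeBruijnNLC

/-! Binary sequences: `false` is the symbol `0`, `true` is the symbol `1`, `!b` is `b ⊕ 1`.
A finite sequence `(s_0, …, s_{n-1})` is a function `Fin n → Bool`, an infinite one is a
function `ℕ → Bool`. -/

/-- The periodic sequence `s^∞ = (s_0, …, s_{n-1}, s_0, …, s_{n-1}, …)`. -/
def perExt {n : ℕ} [NeZero n] (s : Fin n → Bool) : ℕ → Bool :=
  fun i => s (Fin.ofNat n i)

/-- The left circular shift `L(s_0, …, s_{n-1}) = (s_1, …, s_{n-1}, s_0)`. -/
def shiftL {n : ℕ} (s : Fin n → Bool) : Fin n → Bool :=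
  fun i => s ⟨(i.val + 1) % n, Nat.mod_lt _ i.pos⟩

/-- The block `(a_0, …, a_{d-1})` is aperiodic: it is not a repetition of its first `k` terms for
any proper divisor `k` of `d`. -/
def AperiodicBlock (a : ℕ → Bool) (d : ℕ) : Prop :=
  ∀ k, k ∣ d → k < d → ∃ i < d, a i ≠ a (i % k)

/-- `a` has (least) period `n`. -/
def HasLeastPeriod (a : ℕ → Bool) (n : ℕ) : Prop :=
  0 < n ∧ Function.Periodic a n ∧ ∀ p, 0 < p → p < n → ¬ Function.Periodic a p

/-- `a` is an output sequence of the `k`-stage feedback shift register with some feedback function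
`f` (for `k = 0` this says that `a` is constant). -/
def GeneratedByFSR (a : ℕ → Bool) (k : ℕ) : Prop :=
  ∃ f : (Fin k → Bool) → Bool, ∀ i, a (i + k) = f (fun j => a (i + j))

/-- The nonlinear complexity of `a` is `w`: the length of a shortest feedback shift register that
generates `a` is `w`. -/
def HasNlc (a : ℕ → Bool) (w : ℕ) : Prop :=
  IsLeast {k | GeneratedByFSR a k} w

/-- `P(n, w)`: the binary sequences of period `n` with nonlinear complexity `w`. -/
def P (n w : ℕ) : Set (ℕ → Bool) :=
  {a | HasLeastPeriod a n ∧ HasNlc a w}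

/-- `a` is a binary de Bruijn sequence of order `m`: it has period `2^m`, and every binary `m`-tuple
occurs exactly once per period. -/
def IsDeBruijn (m : ℕ) (a : ℕ → Bool) : Prop :=
  HasLeastPeriod a (2 ^ m) ∧
    ∀ w : Fin m → Bool, ∃! i, i < 2 ^ m ∧ ∀ j : Fin m, a (i + j) = w j

/-- `B(n, c, d)`: the aperiodic sequences `s` of length `n` whose first `c + d` terms are
`(s_0, …, s_{d-1})^q (s_0, …, s_{r-1}, s_r ⊕ 1)` with `c + d - 1 = q d + r`, `0 ≤ r < d`, and
`(s_0, …, s_{d-1})` aperiodic; here `1 ≤ c < n` and `1 ≤ d ≤ min (n - c) ⌊n / 2⌋`. All indices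
below are `< n`, so `perExt s` is only used to read off terms of `s` itself. -/
def Bspac (n c d : ℕ) [NeZero n] : Set (Fin n → Bool) :=
  {s | (1 ≤ c ∧ c < n) ∧ (1 ≤ d ∧ d ≤ min (n - c) (n / 2)) ∧
    AperiodicBlock (perExt s) n ∧ AperiodicBlock (perExt s) d ∧
    (∀ j < c + d - 1, perExt s j = perExt s (j % d)) ∧
    perExt s (c + d - 1) = !(perExt s ((c + d - 1) % d))}

/-- `B(n, c) = ⋃_d B(n, c, d)`, over `1 ≤ d ≤ min (n - c) ⌊n / 2⌋`. -/
def B (n c : ℕ) [NeZero n] : Set (Fin n → Bool) :=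
  {s | ∃ d, s ∈ Bspac n c d}

/-- The number of runs of the symbol `b` of length `k` in one period of `s^∞`: strings of `k`
consecutive `b`'s flanked on both sides by the other symbol (a run is counted at the position `p`
just before its first term). -/
def runCount {n : ℕ} [NeZero n] (s : Fin n → Bool) (b : Bool) (k : ℕ) : ℕ :=
  ((Finset.range n).filter fun p =>
    perExt s p ≠ b ∧ (∀ j < k, perExt s (p + 1 + j) = b) ∧ perExt s (p + 1 + k) ≠ b).card

/-- The run properties of order `m`: for each symbol, `2^(m-2-i)` runs of length `i` for
`1 ≤ i < m - 1`, no run of (positive) length `m - 1`, and a single run of length `m`. -/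
def RunProperties {n : ℕ} [NeZero n] (m : ℕ) (s : Fin n → Bool) : Prop :=
  ∀ b : Bool,
    (∀ i, 1 ≤ i → i < m - 1 → runCount s b i = 2 ^ (m - 2 - i)) ∧
    (1 ≤ m - 1 → runCount s b (m - 1) = 0) ∧
    runCount s b m = 1

/-- The reduced set of sequences `(0, …, 0, 1, s_{m+1}, …, s_{n-2}, 1)` (with `m` leading zeros)
that satisfy the run properties. -/
def Btilde (n m : ℕ) [NeZero n] : Set (Fin n → Bool) :=
  {s | (∀ i < m, perExt s i = false) ∧ perExt s m = true ∧ perExt s (n - 1) = true ∧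
    RunProperties m s}

/-- `S(n, m)`: the `s` in the reduced set none of whose shifts `L^k(s)`, `0 < k < n`, lies in
`B(n, m + 1)`. -/
def S (n m : ℕ) [NeZero n] : Set (Fin n → Bool) :=
  {s | s ∈ Btilde n m ∧ ∀ k, 0 < k → k < n → shiftL^[k] s ∉ B n (m + 1)}

end DeBruijnNLC

/-!
A sequence of least period `2 ^ m` is generated by an `m`-stage shift register exactly when its
`m`-windows at the `2 ^ m` positions of a period are pairwise distinct, because two equal states
of a register force a period; by counting, every `m`-tuple then occurs exactly once. A register
with `k` stages has only `2 ^ k` states, so `m` stages are also necessary. This identifies the de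
Bruijn sequences with `P (2 ^ m) m` (`isDeBruijn_iff_mem_P`).

A de Bruijn sequence contains every word of length `L ≤ m` exactly `2 ^ (m - L)` times per period,
which gives the run properties, and membership of a shift in `B n (m + 1)` would produce two equal
`m`-windows (`IsDeBruijn.exists_mem_S`). Conversely, the prescribed runs already fill a period, so
in a sequence of the reduced set the window `0 ⋯ 0` occurs once and `2 ^ m` is the least period.
If some two `m`-windows agreed, consider the least distance `d` of two equal windows and slide
such a pair to the right until the agreement is about to break. The `m + d` terms from there on
have period `d`, the next term violates it, and the block of the first `d` terms is aperiodic by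
minimality of `d`: this is a shift in `B n (m + 1)` (`exists_shift_mem_B`). The bound
`d ≤ n - (m + 1)` needs `m ≥ 3`; for `m ≤ 2` the reduced set is a single explicit sequence.

For the cardinality, a word that begins with `0` and ends with `1` is the same thing as a list of
pairs (length of a run of zeros, length of the following run of ones). The run properties
prescribe the multiset of first components and the multiset of second components, and the
normalization fixes the first run of zeros (`image_ofFn_Btilde`). What remains is a product of two
multinomial coefficients (`card_arrangements_mul`).
-/

open Function
namespace DeBruijnNLC

/-! ### Periodic sequences and shifts -/

theorem perExt_apply {n : ℕ} [NeZero n] (s : Fin n → Bool) (i : ℕ) :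
    perExt s i = s ⟨i % n, Nat.mod_lt _ (NeZero.pos n)⟩ := rfl

theorem perExt_periodic {n : ℕ} [NeZero n] (s : Fin n → Bool) : Periodic (perExt s) n := by
  intro i
  simp [perExt_apply]

theorem perExt_of_lt {n : ℕ} [NeZero n] (s : Fin n → Bool) {i : ℕ} (h : i < n) :
    perExt s i = s ⟨i, h⟩ := by
  simp [perExt_apply, Nat.mod_eq_of_lt h]

theorem perExt_restrict {n : ℕ} [NeZero n] {a : ℕ → Bool} (ha : Periodic a n) :
    perExt (fun i : Fin n => a i) = a := by
  funext i
  simp [perExt_apply, ha.map_mod_nat]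

theorem perExt_shiftL {n : ℕ} [NeZero n] (s : Fin n → Bool) (k i : ℕ) :
    perExt (shiftL^[k] s) i = perExt s (i + k) := by
  induction k generalizing i with
  | zero => rfl
  | succ k ih =>
    have : perExt (shiftL (shiftL^[k] s)) i = perExt (shiftL^[k] s) (i + 1) := by
      simp [perExt_apply, shiftL, Nat.add_mod]
    rw [iterate_succ_apply', this, ih]
    congr 1
    omega

theorem periodic_of_eventually {a : ℕ → Bool} {n d N : ℕ} (hn : 0 < n) (ha : Periodic a n)
    (h : ∀ i, N ≤ i → a (i + d) = a i) : Periodic a d := by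
  intro i
  have h1 := ha.nat_mul N
  have h2 := h (i + N * n) (by nlinarith [Nat.zero_le i])
  rw [show i + N * n + d = (i + d) + N * n by ring] at h2
  have e1 := h1 (i + d)
  have e2 := h1 i
  simp only [Nat.cast_id] at e1 e2
  rw [← e1, ← e2, h2]

theorem HasLeastPeriod.comp_add {a : ℕ → Bool} {n : ℕ} (h : HasLeastPeriod a n) (k : ℕ) :
    HasLeastPeriod (fun i => a (i + k)) n := by
  refine ⟨h.1, fun i => ?_, fun p hp hpn hper => h.2.2 p hp hpn ?_⟩
  · exact (congrArg a (by omega)).trans (h.2.1 (i + k))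
  · refine periodic_of_eventually (N := k) h.1 h.2.1 fun i hi => ?_
    have := hper (i - k)
    simp only at this
    rwa [show i - k + p + k = i + p by omega, show i - k + k = i by omega] at this

/-! ### De Bruijn sequences and nonlinear complexity -/

/-- Two equal states of a feedback shift register force a period. -/
theorem HasLeastPeriod.exists_ne_of_generated {a : ℕ → Bool} {n k : ℕ} (h : HasLeastPeriod a n)
    (hg : GeneratedByFSR a k) {i d : ℕ} (hd : 0 < d) (hdn : d < n) :
    ∃ t < k, a (i + t) ≠ a (i + d + t) := by
  by_contra! hc
  obtain ⟨f, hf⟩ := hg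
  have key : ∀ t, a (i + t) = a (i + d + t) := by
    intro t
    induction t using Nat.strong_induction_on with
    | _ t ih =>
      by_cases ht : t < k
      · exact hc t ht
      · have h1 := hf (i + (t - k))
        have h2 := hf (i + d + (t - k))
        rw [show i + (t - k) + k = i + t by omega] at h1
        rw [show i + d + (t - k) + k = i + d + t by omega] at h2
        rw [h1, h2]
        congr 1
        funext j
        have := ih (t - k + j) (by omega)
        rwa [← add_assoc, ← add_assoc] at this
  refine h.2.2 d hd hdn (periodic_of_eventually (N := i) h.1 h.2.1 fun x hx => ?_)
  have := key (x - i)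
  rw [show i + (x - i) = x by omega, show i + d + (x - i) = x + d by omega] at this
  exact this.symm

theorem two_pow_le_of_generated {a : ℕ → Bool} {n k : ℕ} (h : HasLeastPeriod a n)
    (hg : GeneratedByFSR a k) : n ≤ 2 ^ k := by
  have : Injective (fun (i : Fin n) (j : Fin k) => a (i + j)) := by
    intro i j hij
    by_contra hne
    wlog hlt : i < j generalizing i j
    · exact this hij.symm (Ne.symm hne) (lt_of_le_of_ne (not_lt.1 hlt) (Ne.symm hne))
    have hlt' : i.1 < j.1 := hlt
    obtain ⟨t, ht, hne⟩ := h.exists_ne_of_generated hg (i := i) (d := j - i) (by omega) (by omega)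
    rw [show i.1 + (j.1 - i.1) = j by omega] at hne
    exact hne (congrFun hij ⟨t, ht⟩)
  simpa using Fintype.card_le_of_injective _ this

/-- If the `m`-windows at the positions of `[0, 2^m)` are pairwise distinct, then by counting every
`m`-tuple occurs exactly once there. -/
theorem existsUnique_window {a : ℕ → Bool} {m : ℕ}
    (h : ∀ i j, i < j → j < 2 ^ m → ∃ t < m, a (i + t) ≠ a (j + t)) (w : Fin m → Bool) :
    ∃! i, i < 2 ^ m ∧ ∀ j : Fin m, a (i + j) = w j := by
  have hinj : Injective (fun (i : Fin (2 ^ m)) (j : Fin m) => a (i + j)) := by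
    intro i j hij
    by_contra hne
    wlog hlt : i < j generalizing i j
    · exact this hij.symm (Ne.symm hne) (lt_of_le_of_ne (not_lt.1 hlt) (Ne.symm hne))
    obtain ⟨t, ht, hne⟩ := h i j hlt j.2
    exact hne (congrFun hij ⟨t, ht⟩)
  have hbij := (Fintype.bijective_iff_injective_and_card _).2 ⟨hinj, by simp⟩
  obtain ⟨i, hi⟩ := hbij.2 w
  refine ⟨i, ⟨i.2, fun j => congrFun hi j⟩, fun i' hi' => ?_⟩
  have : (⟨i', hi'.1⟩ : Fin (2 ^ m)) = i := hinj <| by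
    rw [hi]
    exact funext hi'.2
  exact congrArg Fin.val this

theorem IsDeBruijn.generatedByFSR {m : ℕ} {a : ℕ → Bool} (h : IsDeBruijn m a) :
    GeneratedByFSR a m := by
  obtain ⟨hp, hw⟩ := h
  choose pos hpos huniq using hw
  refine ⟨fun w => a (pos w + m), fun i => ?_⟩
  have hmod : ∀ t, a (i % 2 ^ m + t) = a (i + t) := fun t => by
    rw [← hp.2.1.map_mod_nat, Nat.mod_add_mod, hp.2.1.map_mod_nat]
  have := huniq (fun j => a (i + j)) (i % 2 ^ m)
    ⟨Nat.mod_lt _ hp.1, fun j => hmod j⟩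
  change _ = a (pos _ + m)
  rw [← this, hmod]

theorem isDeBruijn_iff_mem_P {m : ℕ} {a : ℕ → Bool} : IsDeBruijn m a ↔ a ∈ P (2 ^ m) m := by
  constructor
  · intro h
    exact ⟨h.1, h.generatedByFSR, fun k hk =>
      (Nat.pow_le_pow_iff_right (by norm_num)).1 (two_pow_le_of_generated h.1 hk)⟩
  · rintro ⟨hp, hg, -⟩
    refine ⟨hp, existsUnique_window fun i j hij hj => ?_⟩
    obtain ⟨t, ht, hne⟩ := hp.exists_ne_of_generated hg (i := i) (d := j - i) (by omega) (by omega)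
    rw [show i + (j - i) = j by omega] at hne
    exact ⟨t, ht, hne⟩

theorem IsDeBruijn.comp_add {m : ℕ} {a : ℕ → Bool} (h : IsDeBruijn m a) (k : ℕ) :
    IsDeBruijn m (fun i => a (i + k)) := by
  refine ⟨h.1.comp_add k, existsUnique_window (a := fun i => a (i + k)) fun i j hij hj => ?_⟩
  obtain ⟨t, ht, hne⟩ := h.1.exists_ne_of_generated h.generatedByFSR (i := i + k) (d := j - i)
    (by omega) (by omega)
  refine ⟨t, ht, ?_⟩
  simpa only [show i + k + t = i + t + k by omega,
    show i + k + (j - i) + t = j + t + k by omega] using hne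

/-! ### Counting windows, run beginnings and runs -/

/-- The number of positions in `[0, n)` at which `k` consecutive symbols `b` begin. -/
def constCount (a : ℕ → Bool) (n : ℕ) (b : Bool) (k : ℕ) : ℕ :=
  ((Finset.range n).filter fun p => ∀ j < k, a (p + j) = b).card

/-- The number of runs of `b` of length at least `k`, counted at the position in `[0, n)` just
before their first term. -/
def longRunCount (a : ℕ → Bool) (n : ℕ) (b : Bool) (k : ℕ) : ℕ :=
  ((Finset.range n).filter fun p => a p ≠ b ∧ ∀ j < k, a (p + 1 + j) = b).card

theorem constCount_eq_add {a : ℕ → Bool} {n : ℕ} (ha : Periodic a n) (b : Bool) (k : ℕ) :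
    constCount a n b k = longRunCount a n b k + constCount a n b (k + 1) := by
  have hshift : constCount a n b k =
      ((Finset.range n).filter fun p => ∀ j < k, a (p + 1 + j) = b).card := by
    unfold constCount
    rw [Finset.card_filter, Finset.card_filter]
    have h1 := Finset.sum_range_succ (fun p => if ∀ j < k, a (p + j) = b then 1 else 0) n
    have h2 := Finset.sum_range_succ' (fun p => if ∀ j < k, a (p + j) = b then 1 else 0) n
    have h3 : (∀ j < k, a (n + j) = b) ↔ ∀ j < k, a (0 + j) = b := by
      simp only [add_comm n, ha _, Nat.zero_add]
    simp only [h3] at h1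
    omega
  rw [hshift, longRunCount, constCount,
    ← Finset.card_filter_add_card_filter_not (fun p => a p ≠ b), Finset.filter_filter,
    Finset.filter_filter]
  congr 2
  · exact Finset.filter_congr fun p _ => and_comm
  · refine Finset.filter_congr fun p _ => ?_
    rw [not_not]
    constructor
    · rintro ⟨h, h0⟩ j hj
      rcases j with _ | j
      · exact h0
      · rw [show p + (j + 1) = p + 1 + j by omega]
        exact h j (by omega)
    · intro h
      refine ⟨fun j hj => ?_, h 0 (by omega)⟩
      rw [show p + 1 + j = p + (j + 1) by omega]
      exact h _ (by omega)

theorem longRunCount_eq_add {n : ℕ} [NeZero n] (s : Fin n → Bool) (b : Bool) (k : ℕ) :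
    longRunCount (perExt s) n b k = runCount s b k + longRunCount (perExt s) n b (k + 1) := by
  rw [longRunCount, ← Finset.card_filter_add_card_filter_not (fun p => perExt s (p + 1 + k) ≠ b),
    Finset.filter_filter, Finset.filter_filter, runCount, longRunCount]
  congr 2
  · exact Finset.filter_congr fun p _ => and_assoc
  · refine Finset.filter_congr fun p _ => ?_
    rw [not_not, and_assoc]
    refine and_congr_right fun _ => ?_
    constructor
    · rintro ⟨h, h0⟩ j hj
      rcases Nat.lt_succ_iff_lt_or_eq.1 hj with hj | rfl
      · exact h j hj
      · exact h0
    · exact fun h => ⟨fun j hj => h j (by omega), h k (by omega)⟩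

theorem constCount_one_add {a : ℕ → Bool} {n : ℕ} :
    constCount a n false 1 + constCount a n true 1 = n := by
  unfold constCount
  have := Finset.card_filter_add_card_filter_not (s := Finset.range n) (fun p => a p = false)
  simpa [Nat.lt_one_iff] using this

/-! ### De Bruijn sequences have the run properties -/

/-- In a de Bruijn sequence of order `m`, a word of length `L ≤ m` occurs `2^(m-L)` times. -/
theorem IsDeBruijn.card_window {m : ℕ} {a : ℕ → Bool} (h : IsDeBruijn m a) (e L : ℕ)
    (hL : L + e = m) (w : ℕ → Bool) :
    ((Finset.range (2 ^ m)).filter fun p => ∀ j < L, a (p + j) = w j).card = 2 ^ e := by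
  induction e generalizing L w with
  | zero =>
    obtain rfl : L = m := by omega
    obtain ⟨i, hi, huniq⟩ := h.2 (fun j => w j)
    rw [pow_zero, Finset.card_eq_one]
    refine ⟨i, Finset.ext fun p => ?_⟩
    simp only [Finset.mem_filter, Finset.mem_range, Finset.mem_singleton]
    constructor
    · exact fun hp => huniq p ⟨hp.1, fun j => hp.2 j j.2⟩
    · rintro rfl
      exact ⟨hi.1, fun j hj => hi.2 ⟨j, hj⟩⟩
  | succ e ih =>
    have split : ∀ b p, ((∀ j < L, a (p + j) = w j) ∧ a (p + L) = b) ↔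
        ∀ j < L + 1, a (p + j) = update w L b j := by
      intro b p
      constructor
      · rintro ⟨h1, h2⟩ j hj
        rcases Nat.lt_succ_iff_lt_or_eq.1 hj with hj | rfl
        · rw [update_of_ne (by omega), h1 j hj]
        · rw [update_self, h2]
      · refine fun h1 => ⟨fun j hj => ?_, ?_⟩
        · rw [h1 j (by omega), update_of_ne (by omega)]
        · rw [h1 L (by omega), update_self]
    rw [← Finset.card_filter_add_card_filter_not (fun p => a (p + L) = true),
      Finset.filter_filter, Finset.filter_filter]
    simp only [Bool.not_eq_true, split]
    rw [ih (L + 1) (by omega), ih (L + 1) (by omega)]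
    ring

theorem IsDeBruijn.constCount_eq {m : ℕ} {a : ℕ → Bool} (h : IsDeBruijn m a) (b : Bool) {k : ℕ}
    (hk : k ≤ m) : constCount a (2 ^ m) b k = 2 ^ (m - k) :=
  h.card_window (m - k) k (by omega) fun _ => b

theorem IsDeBruijn.constCount_succ {m : ℕ} (hm : 1 ≤ m) {a : ℕ → Bool} (h : IsDeBruijn m a)
    (b : Bool) : constCount a (2 ^ m) b (m + 1) = 0 := by
  rw [constCount, Finset.card_eq_zero, Finset.filter_eq_empty_iff]
  intro p _ hp
  obtain ⟨t, ht, hne⟩ := h.1.exists_ne_of_generated h.generatedByFSR (i := p) (d := 1) one_pos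
    (Nat.one_lt_two_pow (by omega))
  rw [add_assoc] at hne
  exact hne ((hp t (by omega)).trans (hp (1 + t) (by omega)).symm)

theorem IsDeBruijn.runProperties {m : ℕ} (hm : 1 ≤ m) {s : Fin (2 ^ m) → Bool}
    (h : IsDeBruijn m (perExt s)) : RunProperties m s := by
  intro b
  have hW := fun k (hk : k ≤ m) => h.constCount_eq b hk
  have hW0 := h.constCount_succ hm b
  have hWN := constCount_eq_add (perExt_periodic s) b
  have hNr := longRunCount_eq_add s b
  have hN : ∀ k, k < m → longRunCount (perExt s) (2 ^ m) b k = 2 ^ (m - k - 1) := by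
    intro k hk
    have := hWN k
    rw [hW k hk.le, hW (k + 1) hk, show m - k = m - k - 1 + 1 by omega, pow_succ,
      show m - (k + 1) = m - k - 1 by omega] at this
    omega
  have hNm : longRunCount (perExt s) (2 ^ m) b m = 1 := by
    have := hWN m
    rw [hW m le_rfl, hW0, Nat.sub_self, pow_zero] at this
    omega
  have hNm1 : longRunCount (perExt s) (2 ^ m) b (m + 1) = 0 := by
    have := hWN (m + 1)
    omega
  refine ⟨fun i hi him => ?_, fun hm1 => ?_, ?_⟩
  · have := hNr i
    rw [hN i (by omega), hN (i + 1) (by omega), show m - i - 1 = m - 2 - i + 1 by omega, pow_succ,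
      show m - (i + 1) - 1 = m - 2 - i by omega] at this
    omega
  · have := hNr (m - 1)
    rw [hN (m - 1) (by omega), show m - 1 + 1 = m by omega, hNm,
      show m - (m - 1) - 1 = 0 by omega] at this
    omega
  · have := hNr m
    omega

/-- Membership in `B n (m + 1)` makes two `m`-windows at distance `d < n` agree. -/
theorem exists_windows_eq_of_mem_B {n m : ℕ} [NeZero n] {s : Fin n → Bool} (h : s ∈ B n (m + 1)) :
    ∃ d, 0 < d ∧ d < n ∧ ∀ j < m, perExt s j = perExt s (d + j) := by
  obtain ⟨d, ⟨-, hcn⟩, ⟨hd, hdn⟩, -, -, hper, -⟩ := h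
  have := le_min_iff.1 hdn
  refine ⟨d, hd, by omega, fun j hj => ?_⟩
  rw [hper j (by omega), hper (d + j) (by omega), Nat.add_mod_left]

theorem IsDeBruijn.exists_mem_S {m : ℕ} (hm : 1 ≤ m) {a : ℕ → Bool} (h : IsDeBruijn m a) :
    ∃ s ∈ S (2 ^ m) m, ∃ k < 2 ^ m, a = perExt (shiftL^[k] s) := by
  obtain ⟨p, ⟨hp, hp0⟩, -⟩ := h.2 (fun _ => false)
  have hper := h.1.2.1
  have hb := h.comp_add p
  set s : Fin (2 ^ m) → Bool := fun i => a (i + p)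
  have hs : perExt s = fun i => a (i + p) := perExt_restrict hb.1.2.1
  have hs0 : ∀ i < m, perExt s i = false := fun i hi => by
    rw [hs, ← hp0 ⟨i, hi⟩]
    exact congrArg a (add_comm _ _)
  rw [← hs] at hb
  have hn : 1 < 2 ^ m := Nat.one_lt_two_pow (by omega)
  have hne : ∀ i d, 0 < d → d < 2 ^ m → ∃ t < m, perExt s (i + t) ≠ perExt s (i + d + t) :=
    fun i d => hb.1.exists_ne_of_generated hb.generatedByFSR
  refine ⟨s, ⟨⟨hs0, ?_, ?_, hb.runProperties hm⟩, fun k hk hkn hB => ?_⟩, (2 ^ m - p) % 2 ^ m,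
    Nat.mod_lt _ h.1.1, ?_⟩
  · -- Otherwise the windows at `0` and `1` both vanish.
    by_contra hc
    rw [Bool.not_eq_true] at hc
    obtain ⟨t, ht, hne⟩ := hne 0 1 one_pos hn
    rw [zero_add, zero_add, hs0 t ht] at hne
    rcases Nat.lt_or_ge (1 + t) m with h1 | h1
    · exact hne (hs0 _ h1).symm
    · rw [show 1 + t = m by omega, hc] at hne
      exact hne rfl
  · -- Otherwise the windows at `2 ^ m - 1` and `2 ^ m`, that is `0`, both vanish.
    by_contra hc
    rw [Bool.not_eq_true] at hc
    obtain ⟨t, ht, hne⟩ := hne (2 ^ m - 1) 1 one_pos hn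
    rw [show 2 ^ m - 1 + 1 + t = t + 2 ^ m by omega, perExt_periodic s t, hs0 t ht] at hne
    rcases t with _ | t
    · exact hne hc
    · rw [show 2 ^ m - 1 + (t + 1) = t + 2 ^ m by omega, perExt_periodic s t,
        hs0 t (by omega)] at hne
      exact hne rfl
  · obtain ⟨d, hd, hdn, hd'⟩ := exists_windows_eq_of_mem_B hB
    obtain ⟨t, ht, hne⟩ := hne k d hd hdn
    have := hd' t ht
    rw [perExt_shiftL, perExt_shiftL, add_comm t k, show d + t + k = k + d + t by omega] at this
    exact hne this
  · funext i
    rw [perExt_shiftL, ← (perExt_periodic s).map_mod_nat, Nat.add_mod_mod,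
      (perExt_periodic s).map_mod_nat, hs]
    simp only
    rw [show i + (2 ^ m - p) + p = i + 2 ^ m by omega, hper]

/-! ### Run properties exhaust a period -/

theorem RunProperties.longRunCount_eq {n m : ℕ} [NeZero n] {s : Fin n → Bool}
    (h : RunProperties m s) (b : Bool) {e : ℕ} (he : e + 1 < m) :
    longRunCount (perExt s) n b (m - 1 - e) = 2 ^ e + longRunCount (perExt s) n b (m + 1) := by
  obtain ⟨h1, h2, h3⟩ := h b
  induction e with
  | zero =>
    have e1 := longRunCount_eq_add s b (m - 1)
    have e2 := longRunCount_eq_add s b m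
    rw [h2 (by omega), show m - 1 + 1 = m by omega, e2, h3] at e1
    simpa using e1
  | succ e ih =>
    rw [longRunCount_eq_add, h1 _ (by omega) (by omega),
      show m - 1 - (e + 1) + 1 = m - 1 - e by omega, ih (by omega),
      show m - 2 - (m - 1 - (e + 1)) = e by omega, pow_succ]
    omega

theorem RunProperties.constCount_eq {n m : ℕ} [NeZero n] {s : Fin n → Bool}
    (h : RunProperties m s) (b : Bool) {e : ℕ} (he : e < m) :
    constCount (perExt s) n b (m - e) = 2 ^ e + (e + 1) * longRunCount (perExt s) n b (m + 1) +
      constCount (perExt s) n b (m + 1) := by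
  induction e with
  | zero =>
    have e2 := longRunCount_eq_add s b m
    rw [(h b).2.2] at e2
    rw [Nat.sub_zero, constCount_eq_add (perExt_periodic s), e2]
    simp
  | succ e ih =>
    rw [constCount_eq_add (perExt_periodic s), show m - (e + 1) + 1 = m - e by omega, ih (by omega),
      show m - (e + 1) = m - 1 - e by omega, h.longRunCount_eq b (by omega)]
    ring

/-- The runs of lengths `1, …, m` prescribed by the run properties already fill `2^m` positions, so
there is no longer run. -/
theorem RunProperties.constCount_order {m : ℕ} (hm : 1 ≤ m) {s : Fin (2 ^ m) → Bool}
    (h : RunProperties m s) (b : Bool) : constCount (perExt s) (2 ^ m) b m = 1 := by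
  have h0 := h.constCount_eq false (e := m - 1) (by omega)
  have h1 := h.constCount_eq true (e := m - 1) (by omega)
  have hsum := constCount_one_add (a := perExt s) (n := 2 ^ m)
  rw [show m - (m - 1) = 1 by omega, show m - 1 + 1 = m by omega] at h0 h1
  have hpow : 2 ^ m = 2 ^ (m - 1) + 2 ^ (m - 1) := by
    rw [← two_mul, ← pow_succ', show m - 1 + 1 = m by omega]
  have hX0 : longRunCount (perExt s) (2 ^ m) false (m + 1) ≤
      m * longRunCount (perExt s) (2 ^ m) false (m + 1) := Nat.le_mul_of_pos_left _ hm
  have hX1 : longRunCount (perExt s) (2 ^ m) true (m + 1) ≤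
      m * longRunCount (perExt s) (2 ^ m) true (m + 1) := Nat.le_mul_of_pos_left _ hm
  have hW := h.constCount_eq b (e := 0) (by omega)
  rw [Nat.sub_zero] at hW
  rw [hW]
  cases b <;> simp <;> omega

theorem exists_true_of_mem_Btilde {m : ℕ} (hm : 1 ≤ m) {s : Fin (2 ^ m) → Bool}
    (h : s ∈ Btilde (2 ^ m) m) {i : ℕ} (hi : 0 < i) (hin : i < 2 ^ m) :
    ∃ t < m, perExt s (i + t) = true := by
  by_contra! hc
  simp only [ne_eq, Bool.not_eq_true] at hc
  obtain ⟨p, hp⟩ := Finset.card_eq_one.1 (h.2.2.2.constCount_order hm false)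
  have h0 : 0 ∈ ({p} : Finset ℕ) := by
    rw [← hp]
    simpa using h.1
  have h1 : i ∈ ({p} : Finset ℕ) := by
    rw [← hp]
    simpa [hin] using hc
  rw [Finset.mem_singleton] at h0 h1
  omega

theorem hasLeastPeriod_of_mem_Btilde {m : ℕ} (hm : 1 ≤ m) {s : Fin (2 ^ m) → Bool}
    (h : s ∈ Btilde (2 ^ m) m) : HasLeastPeriod (perExt s) (2 ^ m) := by
  refine ⟨by positivity, perExt_periodic s, fun p hp hpn hper => ?_⟩
  obtain ⟨t, ht, htt⟩ := exists_true_of_mem_Btilde hm h hp hpn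
  rw [add_comm, hper, h.1 t ht] at htt
  cases htt

/-! ### A sequence with equal windows has a shift in `B n (m + 1)` -/

theorem HasLeastPeriod.aperiodicBlock {a : ℕ → Bool} {n : ℕ} (h : HasLeastPeriod a n) :
    AperiodicBlock a n := by
  intro k hk hkn
  by_contra! hc
  refine h.2.2 k (Nat.pos_of_dvd_of_pos hk h.1) hkn ?_
  have key : ∀ x, a x = a (x % k) := fun x => by
    rw [← h.2.1.map_mod_nat, hc _ (Nat.mod_lt _ h.1), Nat.mod_mod_of_dvd _ hk]
  intro x
  rw [key, Nat.add_mod_right, ← key]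

theorem eq_mod_of_agree {a : ℕ → Bool} {d m : ℕ} (hd : 0 < d)
    (h : ∀ t < m, a t = a (d + t)) (j : ℕ) (hj : j < m + d) : a j = a (j % d) := by
  induction j using Nat.strong_induction_on with
  | _ j ih =>
    by_cases hjd : j < d
    · rw [Nat.mod_eq_of_lt hjd]
    · have h1 := h (j - d) (by omega)
      rw [show d + (j - d) = j by omega] at h1
      rw [← h1, ih (j - d) (by omega) (by omega), ← Nat.mod_eq_sub_mod (by omega)]

/-- If the `m`-windows of a sequence of least period `n` are not pairwise distinct, the least
distance `d` at which two of them agree gives a shift in `B n (m + 1)`. -/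
theorem exists_shift_mem_B {n m : ℕ} [NeZero n] {s : Fin n → Bool}
    (hs : HasLeastPeriod (perExt s) n)
    (hnm : n / 2 + m + 1 ≤ n) {i₀ d₀ : ℕ} (hd₀ : 0 < d₀) (hd₀n : d₀ < n)
    (heq : ∀ t < m, perExt s (i₀ + t) = perExt s (i₀ + d₀ + t)) :
    ∃ k < n, shiftL^[k] s ∈ B n (m + 1) := by
  classical
  have hex : ∃ d, 0 < d ∧ ∃ i, ∀ t < m, perExt s (i + t) = perExt s (i + d + t) :=
    ⟨d₀, hd₀, i₀, heq⟩
  obtain ⟨d, ⟨hd, i, hi⟩, hmin⟩ : ∃ d,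
      (0 < d ∧ ∃ i, ∀ t < m, perExt s (i + t) = perExt s (i + d + t)) ∧
      ∀ e, 0 < e → e < d → ¬ ∃ i, ∀ t < m, perExt s (i + t) = perExt s (i + e + t) :=
    ⟨Nat.find hex, Nat.find_spec hex, fun e he hed hc => Nat.find_min hex hed ⟨he, hc⟩⟩
  have hdn : d < n := lt_of_le_of_lt (not_lt.1 fun h => hmin d₀ hd₀ h ⟨i₀, heq⟩) hd₀n
  -- Going around the period, windows at distance `d` are also at distance `n - d`.
  have hd2 : d ≤ n / 2 := by
    by_contra hc
    refine hmin (n - d) (by omega) (by omega) ⟨i + d, fun t ht => ?_⟩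
    rw [← hi t ht, show i + d + (n - d) + t = i + t + n by omega, perExt_periodic s (i + t)]
  -- Slide the agreement to the right until it is about to break.
  have hbreak : ∃ l, perExt s (i + l) ≠ perExt s (i + d + l) := by
    by_contra! hc
    refine hs.2.2 d hd hdn (periodic_of_eventually (N := i) hs.1 hs.2.1 fun x hx => ?_)
    have := hc (x - i)
    rw [show i + (x - i) = x by omega, show i + d + (x - i) = x + d by omega] at this
    exact this.symm
  obtain ⟨l, hl, hlmin⟩ : ∃ l, perExt s (i + l) ≠ perExt s (i + d + l) ∧
      ∀ t < l, perExt s (i + t) = perExt s (i + d + t) :=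
    ⟨Nat.find hbreak, Nat.find_spec hbreak, fun t ht => not_not.1 (Nat.find_min hbreak ht)⟩
  have hml : m ≤ l := not_lt.1 fun h => hl (hi l h)
  have hshift : ∀ x, perExt (shiftL^[(i + (l - m)) % n] s) x = perExt s (x + (i + (l - m))) := by
    intro x
    rw [perExt_shiftL, ← (perExt_periodic s).map_mod_nat, Nat.add_mod_mod,
      (perExt_periodic s).map_mod_nat]
  refine ⟨(i + (l - m)) % n, Nat.mod_lt _ hs.1, d, ?_⟩
  set u := shiftL^[(i + (l - m)) % n] s with hu
  have hagree : ∀ t < m, perExt u t = perExt u (d + t) := by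
    intro t ht
    rw [hshift, hshift, show t + (i + (l - m)) = i + (t + (l - m)) by omega,
      hlmin _ (by omega)]
    exact congrArg _ (by omega)
  have hmod := eq_mod_of_agree hd hagree
  have hlast : perExt u m ≠ perExt u (d + m) := by
    rw [hshift, hshift, show m + (i + (l - m)) = i + l by omega,
      show d + m + (i + (l - m)) = i + d + l by omega]
    exact hl
  refine ⟨by omega, ⟨hd, le_min (by omega) hd2⟩, ?_, ?_, ?_, ?_⟩
  · have := hs.comp_add (i + (l - m))
    rw [show (fun x => perExt s (x + (i + (l - m)))) = perExt u from (funext hshift).symm] at this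
    exact this.aperiodicBlock
  · -- A period `e` of the block would be a smaller distance between equal windows.
    intro e he hed
    by_contra! hc
    have hmod' : ∀ x < m + d, perExt u x = perExt u (x % e) := fun x hx => by
      rw [hmod x hx, hc _ (Nat.mod_lt _ hd), Nat.mod_mod_of_dvd _ he]
    refine hmin e (Nat.pos_of_dvd_of_pos he hd) hed ⟨i + (l - m), fun t ht => ?_⟩
    have h1 := hmod' t (by omega)
    have h2 := hmod' (e + t) (by omega)
    rw [Nat.add_mod_left, ← h1, hshift, hshift] at h2
    rw [add_comm _ t, ← h2]
    exact congrArg _ (by omega)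
  · intro j hj
    exact hmod j (by omega)
  · rw [show m + 1 + d - 1 = d + m by omega, Nat.add_mod_left, ← hmod m (by omega)]
    cases h1 : perExt u m <;> cases h2 : perExt u (d + m) <;> simp_all

theorem isDeBruijn_of_mem_S {m : ℕ} (hm : 1 ≤ m) {s : Fin (2 ^ m) → Bool}
    (h : s ∈ S (2 ^ m) m) : IsDeBruijn m (perExt s) := by
  have hs := hasLeastPeriod_of_mem_Btilde hm h.1
  refine ⟨hs, existsUnique_window fun i j hij hj => ?_⟩
  rcases Nat.lt_or_ge m 3 with hm3 | hm3
  · -- For `m ≤ 2` the prescribed terms determine the whole sequence.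
    obtain ⟨⟨h0, h1, h2, -⟩, -⟩ := h
    interval_cases m
    · have a0 := h0 0 (by norm_num)
      norm_num at hj
      obtain rfl : j = 1 := by omega
      obtain rfl : i = 0 := by omega
      exact ⟨0, by norm_num, by simp [a0, h1]⟩
    · have a0 := h0 0 (by norm_num)
      have a1 := h0 1 (by norm_num)
      have a4 : perExt s 4 = false := by
        have := perExt_periodic s 0
        norm_num at this
        rw [this, a0]
      norm_num at hj h2
      by_cases he : perExt s i = perExt s j
      · refine ⟨1, by norm_num, ?_⟩
        interval_cases j <;> interval_cases i <;> simp_all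
      · exact ⟨0, by norm_num, he⟩
  · by_contra! hc
    have hpow : m + 1 ≤ 2 ^ (m - 1) := by
      obtain ⟨k, rfl⟩ : ∃ k, m = k + 3 := ⟨m - 3, by omega⟩
      have := Nat.lt_two_pow_self (n := k)
      rw [show k + 3 - 1 = k + 2 by omega, pow_add]
      omega
    have hpow' : 2 ^ m = 2 * 2 ^ (m - 1) := by
      rw [← pow_succ', show m - 1 + 1 = m by omega]
    obtain ⟨k, hk, hB⟩ := exists_shift_mem_B (m := m) hs (by omega) (i₀ := i) (d₀ := j - i)
      (by omega) (by omega) (by rwa [show i + (j - i) = j by omega])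
    rcases Nat.eq_zero_or_pos k with rfl | hk0
    · -- `s` itself is not in `B`, since the window `0 ⋯ 0` does not reappear.
      obtain ⟨d, hd, hdn, heq⟩ := exists_windows_eq_of_mem_B hB
      obtain ⟨t, ht, htt⟩ := exists_true_of_mem_Btilde hm h.1 hd hdn
      have := heq t ht
      rw [iterate_zero, id, htt, h.1.1 t ht] at this
      cases this
    · exact h.2 k hk0 hk hB

/-! ### Encoding sequences by their run lengths -/

/-- The word `0^(z₁+1) 1^(o₁+1) 0^(z₂+1) 1^(o₂+1) ⋯` of a list of pairs `(zᵢ, oᵢ)`. Run lengths are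
stored diminished by one, so that every list of pairs of natural numbers is allowed. -/
def encodeRuns : List (ℕ × ℕ) → List Bool
  | [] => []
  | (z, o) :: l => List.replicate (z + 1) false ++ (List.replicate (o + 1) true ++ encodeRuns l)

/-- A left inverse of `encodeRuns`, reading a word from the right; the first component is the length
of the initial run of ones. -/
def decodeRuns : List Bool → ℕ × List (ℕ × ℕ)
  | [] => (0, [])
  | true :: w => ((decodeRuns w).1 + 1, (decodeRuns w).2)
  | false :: w =>
    match decodeRuns w with
    | (0, []) => (0, [])
    | (0, (z, o) :: l) => (0, (z + 1, o) :: l)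
    | (k + 1, l) => (0, (0, k) :: l)

theorem decodeRuns_encodeRuns (l : List (ℕ × ℕ)) : decodeRuns (encodeRuns l) = (0, l) := by
  have hones : ∀ k w, decodeRuns (List.replicate k true ++ w) =
      ((decodeRuns w).1 + k, (decodeRuns w).2) := by
    intro k w
    induction k with
    | zero => rfl
    | succ k ih => rw [List.replicate_succ, List.cons_append, decodeRuns, ih]; rfl
  induction l with
  | nil => rfl
  | cons x l ih =>
    obtain ⟨z, o⟩ := x
    rw [encodeRuns]
    induction z with
    | zero =>
      rw [List.replicate_succ, List.replicate_zero, List.cons_append, List.nil_append, decodeRuns,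
        hones, ih, Nat.zero_add]
    | succ z ihz => rw [List.replicate_succ, List.cons_append, decodeRuns, ihz]

theorem encodeRuns_injective : Injective encodeRuns := by
  intro l l' h
  have := congrArg decodeRuns h
  rw [decodeRuns_encodeRuns, decodeRuns_encodeRuns] at this
  exact congrArg Prod.snd this

theorem exists_eq_encodeRuns (w : List Bool) (hw : ∀ h : w ≠ [], w.getLast h = true) :
    ∃ k l, w = List.replicate k true ++ encodeRuns l := by
  induction w with
  | nil => exact ⟨0, [], rfl⟩
  | cons x w ih =>
    obtain ⟨k, l, hkl⟩ := ih fun h => by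
      rw [← hw (List.cons_ne_nil _ _), List.getLast_cons h]
    cases x with
    | true => exact ⟨k + 1, l, by rw [hkl, List.replicate_succ, List.cons_append]⟩
    | false =>
      rcases k with _ | k
      · rcases l with _ | ⟨⟨z, o⟩, l⟩
        · subst hkl
          simp [encodeRuns] at hw
        · refine ⟨0, (z + 1, o) :: l, ?_⟩
          rw [hkl, encodeRuns, encodeRuns, List.replicate_succ (n := z + 1)]
          rfl
      · refine ⟨0, (0, k) :: l, ?_⟩
        rw [hkl, encodeRuns]
        rfl

theorem encodeRuns_getLast (l : List (ℕ × ℕ)) (h : encodeRuns l ≠ []) :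
    (encodeRuns l).getLast h = true := by
  induction l with
  | nil => exact absurd rfl h
  | cons x l ih =>
    obtain ⟨z, o⟩ := x
    by_cases hl : encodeRuns l = []
    · simp [encodeRuns, hl]
    · simp only [encodeRuns]
      rw [List.getLast_append_of_ne_nil _ (by simp), List.getLast_append_of_ne_nil _ hl, ih]

theorem length_encodeRuns (l : List (ℕ × ℕ)) : (encodeRuns l).length =
    ((l.map Prod.fst).map (· + 1)).sum + ((l.map Prod.snd).map (· + 1)).sum := by
  induction l with
  | nil => rfl
  | cons x l ih =>
    obtain ⟨z, o⟩ := x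
    simp only [encodeRuns, List.length_append, List.length_replicate, ih, List.map_cons,
      List.sum_cons]
    omega

/-! ### Run counts of an encoded sequence -/

/-- The word `w` stands in the sequence `a` at position `p`. -/
def OccursAt (a : ℕ → Bool) (p : ℕ) (w : List Bool) : Prop :=
  ∀ j (h : j < w.length), a (p + j) = w[j]

theorem occursAt_append {a : ℕ → Bool} {p : ℕ} {u v : List Bool} :
    OccursAt a p (u ++ v) ↔ OccursAt a p u ∧ OccursAt a (p + u.length) v := by
  constructor
  · refine fun h => ⟨fun j hj => ?_, fun j hj => ?_⟩
    · rw [h j (by rw [List.length_append]; omega), List.getElem_append_left hj]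
    · rw [add_assoc, h (u.length + j) (by rw [List.length_append]; omega),
        List.getElem_append_right (by omega)]
      simp
  · rintro ⟨h1, h2⟩ j hj
    rw [List.length_append] at hj
    by_cases hju : j < u.length
    · rw [h1 j hju, List.getElem_append_left hju]
    · rw [List.getElem_append_right (by omega), ← h2 (j - u.length) (by omega)]
      exact congrArg a (by omega)

theorem occursAt_replicate {a : ℕ → Bool} {p k : ℕ} {b : Bool} :
    OccursAt a p (List.replicate k b) ↔ ∀ j < k, a (p + j) = b := by
  simp [OccursAt]

theorem occursAt_encodeRuns_cons {a : ℕ → Bool} {p z o : ℕ} {l : List (ℕ × ℕ)} :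
    OccursAt a p (encodeRuns ((z, o) :: l)) ↔
      (∀ j < z + 1, a (p + j) = false) ∧ (∀ j < o + 1, a (p + (z + 1) + j) = true) ∧
        OccursAt a (p + (z + o + 2)) (encodeRuns l) := by
  rw [encodeRuns, occursAt_append, occursAt_append, occursAt_replicate, List.length_replicate,
    occursAt_replicate, List.length_replicate,
    show p + (z + 1) + (o + 1) = p + (z + o + 2) by omega]

/-- A run of `b` of length `k` begins in `a` right after position `p`. -/
abbrev RunAfter (a : ℕ → Bool) (b : Bool) (k p : ℕ) : Prop :=
  a p ≠ b ∧ (∀ j < k, a (p + 1 + j) = b) ∧ a (p + 1 + k) ≠ b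

/-- The symbols `0^(k+1) 1` stand in `a` at position `p`. -/
abbrev ZerosAt (a : ℕ → Bool) (k p : ℕ) : Prop :=
  (∀ j < k + 1, a (p + j) = false) ∧ a (p + (k + 1)) = true

theorem zerosAt_iff {a : ℕ → Bool} {p z : ℕ} (k : ℕ) (hz : ZerosAt a z p) :
    ZerosAt a k p ↔ z = k := by
  constructor
  · intro hk
    rcases lt_trichotomy z k with h | h | h
    · exact absurd (hk.1 (z + 1) (by omega)) (by simp [hz.2])
    · exact h
    · exact absurd (hz.1 (k + 1) (by omega)) (by simp [hk.2])
  · rintro rfl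
    exact hz

theorem card_runAfter_true_block {a : ℕ → Bool} {p z o : ℕ}
    (hz : ∀ j < z + 1, a (p + j) = false) (ho : ∀ j < o + 1, a (p + (z + 1) + j) = true)
    (hnext : a (p + (z + o + 2)) = false) (k : ℕ) :
    ((Finset.Ico p (p + (z + o + 2))).filter (RunAfter a true (k + 1))).card =
      if o = k then 1 else 0 := by
  have key : ∀ q ∈ Finset.Ico p (p + (z + o + 2)), RunAfter a true (k + 1) q ↔
      q = p + z ∧ o = k := by
    intro q hq
    rw [Finset.mem_Ico] at hq
    constructor
    · rintro ⟨h0, h1, h2⟩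
      have hqz : q = p + z := by
        rcases lt_trichotomy q (p + z) with h | h | h
        · have e1 := h1 0 (by omega)
          have e2 := hz (q + 1 - p) (by omega)
          rw [show p + (q + 1 - p) = q + 1 + 0 by omega, e1] at e2
          cases e2
        · exact h
        · have e2 := ho (q - (p + (z + 1))) (by omega)
          rw [show p + (z + 1) + (q - (p + (z + 1))) = q by omega] at e2
          exact absurd e2 h0
      subst hqz
      refine ⟨rfl, ?_⟩
      rcases lt_trichotomy o k with h | h | h
      · have e1 := h1 (o + 1) (by omega)
        rw [show p + z + 1 + (o + 1) = p + (z + o + 2) by omega, hnext] at e1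
        cases e1
      · exact h
      · have e1 := ho (k + 1) (by omega)
        exact absurd e1 h2
    · rintro ⟨rfl, rfl⟩
      refine ⟨by simp [hz z (by omega)], ho, ?_⟩
      rw [show p + z + 1 + (o + 1) = p + (z + o + 2) by omega, hnext]
      simp
  rw [Finset.filter_congr key]
  by_cases h : o = k
  · simp only [h, and_true, if_true, Finset.filter_eq']
    rw [if_pos (by rw [Finset.mem_Ico]; omega), Finset.card_singleton]
  · simp [h]

theorem card_runAfter_false_block {a : ℕ → Bool} {p z o : ℕ}
    (hz : ∀ j < z + 1, a (p + j) = false) (ho : ∀ j < o + 1, a (p + (z + 1) + j) = true) (k : ℕ) :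
    ((Finset.Ico p (p + (z + o + 2))).filter (RunAfter a false (k + 1))).card =
      if ZerosAt a k (p + (z + o + 2)) then 1 else 0 := by
  have key : ∀ q ∈ Finset.Ico p (p + (z + o + 2)), RunAfter a false (k + 1) q ↔
      q = p + (z + o + 1) ∧ ZerosAt a k (p + (z + o + 2)) := by
    intro q hq
    rw [Finset.mem_Ico] at hq
    constructor
    · rintro ⟨h0, h1, h2⟩
      have hqz : q = p + (z + o + 1) := by
        by_contra hne
        rcases Nat.lt_or_ge q (p + (z + 1)) with h | h
        · have e2 := hz (q - p) (by omega)
          rw [show p + (q - p) = q by omega] at e2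
          exact absurd e2 h0
        · have e1 := h1 0 (by omega)
          have e2 := ho (q + 1 - (p + (z + 1))) (by omega)
          rw [show p + (z + 1) + (q + 1 - (p + (z + 1))) = q + 1 + 0 by omega, e1] at e2
          cases e2
      subst hqz
      exact ⟨rfl, h1, Bool.not_eq_false _ ▸ h2⟩
    · rintro ⟨rfl, h1, h2⟩
      refine ⟨?_, h1, ?_⟩
      · have e2 := ho o (by omega)
        rw [show p + (z + 1) + o = p + (z + o + 1) by omega] at e2
        simp [e2]
      · change a (p + (z + o + 2) + (k + 1)) ≠ false
        simp [h2]
  rw [Finset.filter_congr key]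
  by_cases h : ZerosAt a k (p + (z + o + 2))
  · rw [if_pos h, Finset.card_eq_one]
    refine ⟨p + (z + o + 1), Finset.ext fun q => ?_⟩
    rw [Finset.mem_filter, Finset.mem_Ico, Finset.mem_singleton]
    exact ⟨fun hq => hq.2.1, fun hq => ⟨by omega, hq, h⟩⟩
  · simp [h]

theorem card_filter_Ico_add {q : ℕ → Prop} [DecidablePred q] (p u v : ℕ) :
    ((Finset.Ico p (p + (u + v))).filter q).card =
      ((Finset.Ico p (p + u)).filter q).card +
        ((Finset.Ico (p + u) (p + u + v)).filter q).card := by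
  simp only [Finset.card_filter]
  rw [← add_assoc, Finset.sum_Ico_consecutive _ (by omega) (by omega)]

theorem length_encodeRuns_cons (z o : ℕ) (l : List (ℕ × ℕ)) :
    (encodeRuns ((z, o) :: l)).length = z + o + 2 + (encodeRuns l).length := by
  simp only [encodeRuns, List.length_append, List.length_replicate]
  omega

theorem OccursAt.next_eq_false {a : ℕ → Bool} {p : ℕ} {l : List (ℕ × ℕ)}
    (h : OccursAt a p (encodeRuns l)) (hnext : a (p + (encodeRuns l).length) = false) :
    a p = false := by
  rcases l with _ | ⟨⟨z, o⟩, l⟩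
  · exact hnext
  · exact (occursAt_encodeRuns_cons.1 h).1 0 (by omega)

theorem card_runAfter_true {a : ℕ → Bool} {p : ℕ} {l : List (ℕ × ℕ)}
    (h : OccursAt a p (encodeRuns l)) (hnext : a (p + (encodeRuns l).length) = false) (k : ℕ) :
    ((Finset.Ico p (p + (encodeRuns l).length)).filter (RunAfter a true (k + 1))).card =
      (l.map Prod.snd).count k := by
  induction l generalizing p with
  | nil => simp [encodeRuns]
  | cons x l ih =>
    obtain ⟨z, o⟩ := x
    rw [length_encodeRuns_cons, ← add_assoc p] at hnext
    obtain ⟨hz, ho, h⟩ := occursAt_encodeRuns_cons.1 h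
    rw [length_encodeRuns_cons, card_filter_Ico_add, ih h hnext,
      card_runAfter_true_block hz ho (h.next_eq_false hnext), List.map_cons, List.count_cons]
    simp only [beq_iff_eq]
    exact add_comm _ _

/-- Each block contributes the run of zeros of the following block, hence the two corrections. -/
theorem card_runAfter_false {a : ℕ → Bool} {p : ℕ} {l : List (ℕ × ℕ)}
    (h : OccursAt a p (encodeRuns l)) (hnext : a (p + (encodeRuns l).length) = false) (k : ℕ) :
    ((Finset.Ico p (p + (encodeRuns l).length)).filter (RunAfter a false (k + 1))).card +
        (if ZerosAt a k p then 1 else 0) =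
      (l.map Prod.fst).count k + if ZerosAt a k (p + (encodeRuns l).length) then 1 else 0 := by
  induction l generalizing p with
  | nil => simp [encodeRuns]
  | cons x l ih =>
    obtain ⟨z, o⟩ := x
    rw [length_encodeRuns_cons, ← add_assoc p] at hnext
    obtain ⟨hz, ho, h⟩ := occursAt_encodeRuns_cons.1 h
    have hz' : ZerosAt a z p := ⟨hz, ho 0 (by omega)⟩
    have := ih h hnext
    rw [length_encodeRuns_cons, card_filter_Ico_add, card_runAfter_false_block hz ho,
      List.map_cons, List.count_cons, ← add_assoc p (z + o + 2)]
    simp only [beq_iff_eq, zerosAt_iff k hz']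
    omega

theorem runCount_of_encodeRuns {n : ℕ} [NeZero n] {s : Fin n → Bool} {l : List (ℕ × ℕ)}
    (h : OccursAt (perExt s) 0 (encodeRuns l)) (hlen : (encodeRuns l).length = n) (k : ℕ) :
    runCount s false (k + 1) = (l.map Prod.fst).count k ∧
      runCount s true (k + 1) = (l.map Prod.snd).count k := by
  have hper : ∀ j, perExt s (n + j) = perExt s (0 + j) := fun j => by
    rw [add_comm n, perExt_periodic, zero_add]
  have hl : perExt s 0 = false := by
    rcases l with _ | ⟨⟨z, o⟩, l⟩
    · exact absurd hlen (by simpa [encodeRuns] using (NeZero.ne n).symm)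
    · exact (occursAt_encodeRuns_cons.1 h).1 0 (by omega)
  have hnext : perExt s (0 + (encodeRuns l).length) = false := by
    rw [hlen, zero_add, ← hl]
    exact hper 0
  have h0 := card_runAfter_false h hnext k
  have h1 := card_runAfter_true h hnext k
  rw [hlen, zero_add, ← Finset.range_eq_Ico] at h0 h1
  have hZ : ZerosAt (perExt s) k n ↔ ZerosAt (perExt s) k 0 := by
    simp only [ZerosAt, hper]
  simp only [hZ] at h0
  exact ⟨Nat.add_right_cancel h0, h1⟩

/-! ### The number of lists with a given multiset of entries -/

/-- The finite set of the lists whose multiset of entries is `M`. -/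
def arrangements (M : Multiset ℕ) : Finset (List ℕ) :=
  M.lists.toFinset

theorem mem_arrangements {M : Multiset ℕ} {l : List ℕ} :
    l ∈ arrangements M ↔ (l : Multiset ℕ) = M := by
  rw [arrangements, Multiset.mem_toFinset, Multiset.mem_lists_iff, eq_comm]
  rfl

theorem card_arrangements_cons (M : Multiset ℕ) (hM : M ≠ 0) :
    (arrangements M).card = ∑ x ∈ M.toFinset, (arrangements (M.erase x)).card := by
  have : arrangements M =
      M.toFinset.biUnion fun x => (arrangements (M.erase x)).image (List.cons x) := by
    ext l
    simp only [Finset.mem_biUnion, Multiset.mem_toFinset, Finset.mem_image, mem_arrangements]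
    constructor
    · rintro rfl
      rcases l with _ | ⟨x, l⟩
      · exact absurd rfl hM
      · exact ⟨x, by simp, l, by simp, rfl⟩
    · rintro ⟨x, hx, l, hl, rfl⟩
      rw [← Multiset.cons_coe, hl, Multiset.cons_erase hx]
  rw [this, Finset.card_biUnion]
  · exact Finset.sum_congr rfl fun x _ => Finset.card_image_of_injective _ List.cons_injective
  · intro x _ y _ hxy
    simp only [onFun, Finset.disjoint_left, Finset.mem_image, not_exists, not_and]
    rintro _ ⟨l, -, rfl⟩ l' - h
    exact hxy (List.cons_eq_cons.1 h).1.symm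

/-- The multinomial count of the arrangements of a multiset. -/
theorem card_arrangements_mul (M : Multiset ℕ) (T : Finset ℕ) (hT : M.toFinset ⊆ T) :
    (arrangements M).card * ∏ x ∈ T, (M.count x).factorial = M.card.factorial := by
  induction hc : M.card generalizing M with
  | zero =>
    rw [Multiset.card_eq_zero] at hc
    subst hc
    have : arrangements 0 = {[]} := by
      ext l
      simp [mem_arrangements]
    simp [this]
  | succ c ih =>
    have hM : M ≠ 0 := by
      rintro rfl
      simp at hc
    rw [card_arrangements_cons M hM, Finset.sum_mul]
    have hterm : ∀ x ∈ M.toFinset, (arrangements (M.erase x)).card *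
        ∏ y ∈ T, (M.count y).factorial = M.count x * c.factorial := by
      intro x hx
      have hxM := Multiset.mem_toFinset.1 hx
      have hsub : (M.erase x).toFinset ⊆ T := fun y hy =>
        hT (Multiset.mem_toFinset.2 (Multiset.mem_of_mem_erase (Multiset.mem_toFinset.1 hy)))
      have hpos := Multiset.count_pos.2 hxM
      rw [← ih (M.erase x) hsub (by rw [Multiset.card_erase_of_mem hxM, hc]; rfl),
        ← Finset.mul_prod_erase T _ (hT hx), ← Finset.mul_prod_erase T _ (hT hx),
        Multiset.count_erase_self, ← Nat.mul_factorial_pred hpos.ne',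
        Finset.prod_congr rfl fun y hy => by
          rw [← Multiset.count_erase_of_ne (Finset.ne_of_mem_erase hy)]]
      ring
    rw [Finset.sum_congr rfl hterm, ← Finset.sum_mul, Multiset.toFinset_sum_count_eq, hc,
      Nat.factorial_succ]

/-! ### The run lengths prescribed by the run properties -/

/-- The run lengths, diminished by one, that the run properties of order `t + 2` prescribe for each
symbol, without the run of length `t + 2`: the number `k < t` occurs `2^(t-1-k)` times. -/
def shortRuns : ℕ → Multiset ℕ
  | 0 => 0
  | t + 1 => t ::ₘ (shortRuns t + shortRuns t)

theorem count_shortRuns (t k : ℕ) :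
    (shortRuns t).count k = if k < t then 2 ^ (t - 1 - k) else 0 := by
  induction t with
  | zero => simp [shortRuns]
  | succ t ih =>
    rw [shortRuns, Multiset.count_cons, Multiset.count_add, ih]
    rcases lt_trichotomy k t with h | h | h
    · rw [if_pos h, if_neg h.ne, if_pos (by omega), show t + 1 - 1 - k = t - 1 - k + 1 by omega,
        pow_succ]
      omega
    · simp [h]
    · rw [if_neg (by omega), if_neg (by omega), if_neg (by omega)]

theorem card_shortRuns (t : ℕ) : (shortRuns t).card + 1 = 2 ^ t := by
  induction t with
  | zero => rfl
  | succ t ih =>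
    rw [shortRuns, Multiset.card_cons, Multiset.card_add, pow_succ]
    omega

theorem sum_shortRuns (t : ℕ) : ((shortRuns t).map (· + 1)).sum + (t + 2) = 2 ^ (t + 1) := by
  induction t with
  | zero => rfl
  | succ t ih =>
    rw [shortRuns, Multiset.map_cons, Multiset.sum_cons, Multiset.map_add, Multiset.sum_add,
      pow_succ]
    omega

/-- All run lengths, diminished by one, prescribed for each symbol by the run properties of order
`t + 2`. -/
def allRuns (t : ℕ) : Multiset ℕ :=
  (t + 1) ::ₘ shortRuns t

theorem card_allRuns (t : ℕ) : (allRuns t).card = 2 ^ t := by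
  rw [allRuns, Multiset.card_cons, card_shortRuns]

theorem sum_allRuns (t : ℕ) : ((allRuns t).map (· + 1)).sum = 2 ^ (t + 1) := by
  rw [allRuns, Multiset.map_cons, Multiset.sum_cons, ← sum_shortRuns]
  omega

theorem count_allRuns (t k : ℕ) :
    (allRuns t).count k = if k < t then 2 ^ (t - 1 - k) else if k = t + 1 then 1 else 0 := by
  rw [allRuns, Multiset.count_cons, count_shortRuns]
  split_ifs <;> omega

theorem runProperties_iff {n : ℕ} [NeZero n] (t : ℕ) (s : Fin n → Bool) :
    RunProperties (t + 2) s ↔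
      ∀ b, ∀ k < t + 2, runCount s b (k + 1) = (allRuns t).count k := by
  refine forall_congr' fun b => ?_
  constructor
  · rintro ⟨h1, h2, h3⟩ k hk
    rw [count_allRuns]
    rcases lt_trichotomy k t with h | rfl | h
    · rw [if_pos h, h1 (k + 1) (by omega) (by omega)]
      congr 1
      omega
    · simpa using h2 (by omega)
    · obtain rfl : k = t + 1 := by omega
      simpa using h3
  · refine fun h => ⟨fun i hi hit => ?_, fun _ => ?_, ?_⟩
    · obtain ⟨k, rfl⟩ : ∃ k, i = k + 1 := ⟨i - 1, by omega⟩
      rw [h k (by omega), count_allRuns, if_pos (by omega)]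
      congr 1
      omega
    · have := h t (by omega)
      simpa [count_allRuns] using this
    · have := h (t + 1) (by omega)
      simpa [count_allRuns] using this

theorem card_arrangements_shortRuns (t : ℕ) :
    (arrangements (shortRuns t)).card * ∏ i ∈ Finset.range t, (2 ^ i).factorial =
      (2 ^ t - 1).factorial := by
  have h := card_arrangements_mul (shortRuns t) (Finset.range t) fun x hx => by
    rw [Multiset.mem_toFinset, ← Multiset.count_pos, count_shortRuns] at hx
    rw [Finset.mem_range]
    by_contra hc
    simp [hc] at hx
  rw [← card_shortRuns, Nat.add_sub_cancel, ← h, ← Finset.prod_range_reflect]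
  congr 1
  refine Finset.prod_congr rfl fun i hi => ?_
  rw [count_shortRuns, if_pos (Finset.mem_range.1 hi)]

theorem card_arrangements_allRuns (t : ℕ) :
    (arrangements (allRuns t)).card * ∏ i ∈ Finset.range t, (2 ^ i).factorial =
      (2 ^ t).factorial := by
  have h := card_arrangements_mul (allRuns t) (Finset.range (t + 2)) fun x hx => by
    rw [Multiset.mem_toFinset, ← Multiset.count_pos, count_allRuns] at hx
    rw [Finset.mem_range]
    split_ifs at hx <;> omega
  rw [card_allRuns, Finset.prod_range_succ, Finset.prod_range_succ] at h
  rw [← h, ← Finset.prod_range_reflect]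
  simp only [count_allRuns, lt_irrefl, show ¬ t + 1 < t by omega, if_false, if_true, left_eq_add,
    one_ne_zero, Nat.factorial_zero, Nat.factorial_one, mul_one]
  congr 1
  refine Finset.prod_congr rfl fun i hi => ?_
  rw [if_pos (Finset.mem_range.1 hi)]

/-! ### The size of the reduced set -/

theorem occursAt_perExt_iff {n : ℕ} [NeZero n] {s : Fin n → Bool} {w : List Bool}
    (hw : w.length = n) : OccursAt (perExt s) 0 w ↔ List.ofFn s = w := by
  constructor
  · intro h
    refine List.ext_getElem (by simp [hw]) fun j h1 h2 => ?_
    rw [← h j h2, List.getElem_ofFn, zero_add, perExt_of_lt s (by omega)]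
  · rintro rfl j hj
    rw [List.getElem_ofFn, zero_add, perExt_of_lt]

theorem map_fst_eq_and_map_snd_eq {t : ℕ} {l : List (ℕ × ℕ)}
    (hlen : (encodeRuns l).length = 2 ^ (t + 2))
    (h0 : ∀ k < t + 2, (l.map Prod.fst).count k = (allRuns t).count k)
    (h1 : ∀ k < t + 2, (l.map Prod.snd).count k = (allRuns t).count k) :
    ((l.map Prod.fst : List ℕ) : Multiset ℕ) = allRuns t ∧
      ((l.map Prod.snd : List ℕ) : Multiset ℕ) = allRuns t := by
  have hle : ∀ x : List ℕ, (∀ k < t + 2, x.count k = (allRuns t).count k) →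
      allRuns t ≤ (x : Multiset ℕ) := by
    intro x hx
    rw [Multiset.le_iff_count]
    intro k
    by_cases hk : k < t + 2
    · rw [Multiset.coe_count, hx k hk]
    · rw [count_allRuns, if_neg (by omega), if_neg (by omega)]
      exact Nat.zero_le _
  obtain ⟨u, hu⟩ := Multiset.le_iff_exists_add.1 (hle _ h0)
  obtain ⟨v, hv⟩ := Multiset.le_iff_exists_add.1 (hle _ h1)
  have hsum : ∀ x : List ℕ, (x.map (· + 1)).sum = (((x : Multiset ℕ)).map (· + 1)).sum := by
    intro x
    simp
  rw [length_encodeRuns, hsum, hsum, hu, hv, Multiset.map_add, Multiset.map_add, Multiset.sum_add,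
    Multiset.sum_add, sum_allRuns, pow_succ 2 (t + 1)] at hlen
  -- Every entry counts for at least one, so a superfluous entry would make the word too long.
  have hcard : ∀ x : Multiset ℕ, (x.map (· + 1)).sum = 0 → x = 0 := by
    intro x hx
    rw [Multiset.sum_map_add, Multiset.map_const', Multiset.sum_replicate] at hx
    rw [← Multiset.card_eq_zero]
    simp only [smul_eq_mul, mul_one] at hx
    omega
  rw [hu, hv, hcard u (by omega), hcard v (by omega), add_zero]
  exact ⟨rfl, rfl⟩

theorem image_ofFn_Btilde (t : ℕ) :
    (List.ofFn : (Fin (2 ^ (t + 2)) → Bool) → List Bool) '' Btilde (2 ^ (t + 2)) (t + 2) =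
      (fun q : List ℕ × List ℕ => encodeRuns (((t + 1) :: q.1).zip q.2)) ''
        ((arrangements (shortRuns t) ×ˢ arrangements (allRuns t) : Finset _) :
          Set (List ℕ × List ℕ)) := by
  have hn : 0 < 2 ^ (t + 2) := by positivity
  ext w
  simp only [Set.mem_image, Finset.mem_coe, Finset.mem_product, mem_arrangements, Prod.exists]
  constructor
  · rintro ⟨s, ⟨h0, h1, h2, h3⟩, rfl⟩
    obtain ⟨k, l, hkl⟩ := exists_eq_encodeRuns (List.ofFn s) fun h => by
      rw [List.getLast_ofFn, ← perExt_of_lt s (by omega), h2]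
    have hocc := (occursAt_perExt_iff (by rw [← hkl, List.length_ofFn])).2 hkl
    obtain rfl : k = 0 := by
      by_contra hk
      have := occursAt_replicate.1 (occursAt_append.1 hocc).1 0 (by omega)
      rw [zero_add, h0 0 (by omega)] at this
      cases this
    rw [List.replicate_zero, List.nil_append] at hkl hocc
    have hlen : (encodeRuns l).length = 2 ^ (t + 2) := by rw [← hkl, List.length_ofFn]
    have hrun := runCount_of_encodeRuns hocc hlen
    rw [runProperties_iff] at h3
    obtain ⟨hf, hs⟩ := map_fst_eq_and_map_snd_eq hlen
      (fun k hk => by rw [← (hrun k).1, h3 _ k hk]) (fun k hk => by rw [← (hrun k).2, h3 _ k hk])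
    rcases l with _ | ⟨⟨z, o⟩, l⟩
    · exact absurd hlen (by simpa [encodeRuns] using hn.ne)
    · have hc := occursAt_encodeRuns_cons.1 hocc
      have hz : ZerosAt (perExt s) z 0 := ⟨hc.1, by simpa using hc.2.1 0 (by omega)⟩
      have ht : ZerosAt (perExt s) (t + 1) 0 :=
        ⟨fun j hj => by simpa using h0 j hj, by simpa using h1⟩
      obtain rfl := (zerosAt_iff _ hz).1 ht
      refine ⟨l.map Prod.fst, ((t + 1, o) :: l).map Prod.snd, ⟨?_, hs⟩, ?_⟩
      · rw [List.map_cons, ← Multiset.cons_coe, allRuns] at hf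
        exact (Multiset.cons_inj_right _).1 hf
      · rw [hkl]
        congr 1
        exact (List.zip_map' (f := Prod.fst) (g := Prod.snd) (l := (t + 1, o) :: l)).trans (List.map_id _)
  · rintro ⟨x, y, ⟨hx, hy⟩, rfl⟩
    have hxy : ((t + 1) :: x).length = y.length := by
      rw [← Multiset.coe_card y, hy, card_allRuns, List.length_cons, ← Multiset.coe_card, hx,
        card_shortRuns]
    set l := ((t + 1) :: x).zip y with hl
    have hf : l.map Prod.fst = (t + 1) :: x := List.map_fst_zip hxy.le
    have hs : l.map Prod.snd = y := List.map_snd_zip hxy.ge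
    have hf' : (((t + 1) :: x : List ℕ) : Multiset ℕ) = allRuns t := by
      rw [← Multiset.cons_coe, hx, allRuns]
    have hlen : (encodeRuns l).length = 2 ^ (t + 2) := by
      rw [length_encodeRuns, hf, hs, ← Multiset.sum_coe, ← Multiset.map_coe, hf', sum_allRuns,
        ← Multiset.sum_coe, ← Multiset.map_coe, hy, sum_allRuns, pow_succ 2 (t + 1)]
      omega
    have hof : List.ofFn (fun i : Fin (2 ^ (t + 2)) => (encodeRuns l)[i.1]'(by omega)) =
        encodeRuns l := List.ext_getElem (by simp [hlen]) (by simp)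
    set s : Fin (2 ^ (t + 2)) → Bool := fun i => (encodeRuns l)[i.1]'(by omega) with hsdef
    have hocc := (occursAt_perExt_iff hlen).2 hof
    have hrun := runCount_of_encodeRuns hocc hlen
    obtain ⟨o, l', hl'⟩ : ∃ o l', l = (t + 1, o) :: l' := by
      rcases y with _ | ⟨o, y⟩
      · simp at hxy
      · exact ⟨o, x.zip y, rfl⟩
    have hc := hocc
    rw [hl', occursAt_encodeRuns_cons] at hc
    refine ⟨s, ⟨fun i hi => by simpa using hc.1 i hi, by simpa using hc.2.1 0 (by omega), ?_, ?_⟩,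
      hof⟩
    · have hne : encodeRuns l ≠ [] := List.ne_nil_of_length_pos (by omega)
      rw [← encodeRuns_getLast l hne, List.getLast_eq_getElem, perExt_of_lt s (by omega), hsdef]
      simp only [hlen]
    · rw [runProperties_iff]
      rintro (_ | _) k -
      · rw [(hrun k).1, hf, ← hf', Multiset.coe_count]
      · rw [(hrun k).2, hs, ← hy, Multiset.coe_count]

theorem ncard_Btilde (t : ℕ) : (Btilde (2 ^ (t + 2)) (t + 2)).ncard =
    (arrangements (shortRuns t)).card * (arrangements (allRuns t)).card := by
  rw [← Set.ncard_image_of_injective _ List.ofFn_injective, image_ofFn_Btilde,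
    Set.InjOn.ncard_image, Set.ncard_coe_finset, Finset.card_product]
  rintro ⟨x, y⟩ h ⟨x', y'⟩ h' heq
  have hlen : ∀ {x y : List ℕ}, (x, y) ∈ ((arrangements (shortRuns t) ×ˢ arrangements (allRuns t) :
      Finset _) : Set (List ℕ × List ℕ)) → ((t + 1) :: x).length = y.length := by
    intro x y h
    simp only [Finset.mem_coe, Finset.mem_product, mem_arrangements] at h
    rw [← Multiset.coe_card y, h.2, card_allRuns, List.length_cons, ← Multiset.coe_card, h.1,
      card_shortRuns]
  have hz := encodeRuns_injective heq
  simp only at hz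
  have e1 := congrArg (List.map Prod.fst) hz
  have e2 := congrArg (List.map Prod.snd) hz
  rw [List.map_fst_zip (hlen h).le, List.map_fst_zip (hlen h').le] at e1
  rw [List.map_snd_zip (hlen h).ge, List.map_snd_zip (hlen h').ge] at e2
  rw [(List.cons_eq_cons.1 e1).2, e2]

theorem ncard_Btilde_eq (t : ℕ) : ((Btilde (2 ^ (t + 2)) (t + 2)).ncard : ℚ) =
    1 / 2 ^ t * (((2 ^ t).factorial : ℚ) / ∏ i ∈ Finset.range t, ((2 ^ i).factorial : ℚ)) ^ 2 := by
  have h0 := congrArg (Nat.cast : ℕ → ℚ) (card_arrangements_shortRuns t)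
  have h1 := congrArg (Nat.cast : ℕ → ℚ) (card_arrangements_allRuns t)
  have h2 := congrArg (Nat.cast : ℕ → ℚ) (Nat.mul_factorial_pred (n := 2 ^ t) (by positivity))
  have hP : (∏ i ∈ Finset.range t, ((2 ^ i).factorial : ℚ)) ≠ 0 :=
    Finset.prod_ne_zero_iff.2 fun i _ => by positivity
  push_cast at h0 h1 h2
  push_cast [ncard_Btilde]
  rw [eq_div_of_mul_eq hP h0, eq_div_of_mul_eq hP h1, ← h2]
  field_simp

end DeBruijnNLC

theorem corollary3 (m : ℕ) (hm : 1 ≤ m) :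
    {a | DeBruijnNLC.IsDeBruijn m a} = DeBruijnNLC.P (2 ^ m) m ∧
    DeBruijnNLC.P (2 ^ m) m =
      {a | ∃ s ∈ DeBruijnNLC.S (2 ^ m) m, ∃ k < 2 ^ m,
        a = DeBruijnNLC.perExt (DeBruijnNLC.shiftL^[k] s)} ∧
    (2 ≤ m →
      ((DeBruijnNLC.Btilde (2 ^ m) m).ncard : ℚ) =
        1 / 2 ^ (m - 2) *
          (((2 ^ (m - 2)).factorial : ℚ) /
            ∏ i ∈ Finset.range (m - 2), ((2 ^ i).factorial : ℚ)) ^ 2) := by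
  refine ⟨Set.ext fun a => DeBruijnNLC.isDeBruijn_iff_mem_P,
    Set.ext fun a => ⟨fun ha => ?_, ?_⟩, ?_⟩
  · exact (DeBruijnNLC.isDeBruijn_iff_mem_P.2 ha).exists_mem_S hm
  · rintro ⟨s, hs, k, -, rfl⟩
    have := (DeBruijnNLC.isDeBruijn_of_mem_S hm hs).comp_add k
    rw [show (fun i => DeBruijnNLC.perExt s (i + k)) =
      DeBruijnNLC.perExt (DeBruijnNLC.shiftL^[k] s) from
        funext fun i => (DeBruijnNLC.perExt_shiftL s k i).symm] at this
    exact DeBruijnNLC.isDeBruijn_iff_mem_P.1 this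
  · intro hm2
    obtain ⟨t, rfl⟩ : ∃ t, m = t + 2 := ⟨m - 2, by omega⟩
    exact DeBruijnNLC.ncard_Btilde_eq t
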